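/- All graphs are finite and simple. A configuration on a graph $G$ places a finite number of pebbles (its size) on the vertices of $G$, possibly several on the same vertex. A pebbling move removes two pebbles from a vertex and places one pebble on an adjacent vertex. The pebbling number $\pi(G)$ of a connected graph $G$ is the least $n$ such that, for every configuration of size $n$ and every vertex $r$ of $G$, some finite (possibly empty) sequence of pebbling moves leads to a configuration with at least one pebble on $r$. The strong product $G\boxtimes H$ has vertex set $V(G)\times V(H)$, with $(g,h)$ adjacent to $(g',h')$ if and only if ($g=g'$ and $h\sim_H h'$), or ($h=h'$ and $g\sim_G g'$), or ($g\sim_G g'$ and $h\sim_H h'$). Theorem 4.1. Let $G$ and $H$ be connected graphs. Then $$\pi(G\boxtimes H)\le \tfrac{3}{2}\,(\pi(G)+1)(\pi(H)+1).$$ -/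

import Mathlib

namespace Pebbling

universe u v

/-- The strong product of two simple graphs. -/
def strongProduct {V : Type u} {W : Type v} (G : SimpleGraph V) (H : SimpleGraph W) :
    SimpleGraph (V × W) where
  Adj x y := (x.1 = y.1 ∧ H.Adj x.2 y.2) ∨ (x.2 = y.2 ∧ G.Adj x.1 y.1) ∨
    (G.Adj x.1 y.1 ∧ H.Adj x.2 y.2)
  symm := ⟨by
    rintro x y (⟨h, h'⟩ | ⟨h, h'⟩ | ⟨h, h'⟩)
    · exact Or.inl ⟨h.symm, h'.symm⟩
    · exact Or.inr (Or.inl ⟨h.symm, h'.symm⟩)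
    · exact Or.inr (Or.inr ⟨h.symm, h'.symm⟩)⟩
  loopless := ⟨by
    rintro x (⟨_, h⟩ | ⟨_, h⟩ | ⟨h, _⟩)
    · exact H.irrefl h
    · exact G.irrefl h
    · exact G.irrefl h⟩

/-- A configuration of pebbles: the finite multiset of the vertices that carry pebbles, in which
each vertex occurs as often as it carries pebbles. Its size is `Multiset.card`. -/
abbrev Configuration (V : Type u) := Multiset V

/-- A pebbling move from `C` to `C'`: two pebbles on a vertex `a` are replaced by one pebble on a
neighbour `b` of `a`. -/
def Move {V : Type u} (G : SimpleGraph V) (C C' : Configuration V) : Prop :=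
  ∃ (a b : V) (D : Configuration V), G.Adj a b ∧ C = a ::ₘ a ::ₘ D ∧ C' = b ::ₘ D

/-- `C` is `r`-solvable: some finite (possibly empty) sequence of pebbling moves puts a pebble
on `r`. -/
def Solvable {V : Type u} (G : SimpleGraph V) (C : Configuration V) (r : V) : Prop :=
  ∃ C' : Configuration V, Relation.ReflTransGen (Move G) C C' ∧ r ∈ C'

/-- The pebbling number: the least number `n` such that every configuration of `n` pebbles is
`r`-solvable for every root `r`. The least element exists for every finite connected graph, see
`isLeast_pebblingNumber`. -/
noncomputable def pebblingNumber {V : Type u} (G : SimpleGraph V) : ℕ :=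
  sInf {n : ℕ | ∀ C : Configuration V, Multiset.card C = n → ∀ r : V, Solvable G C r}

/-- Repeating a move along an edge. -/
theorem reach_adj {V : Type u} {G : SimpleGraph V} {a b : V} (h : G.Adj a b) (k : ℕ)
    (D : Configuration V) :
    Relation.ReflTransGen (Move G) (Multiset.replicate (k * 2) a + D)
      (Multiset.replicate k b + D) := by
  induction k generalizing D with
  | zero => simpa using Relation.ReflTransGen.refl
  | succ k ih =>
    refine Relation.ReflTransGen.head (b := Multiset.replicate (k * 2) a + (b ::ₘ D)) ?_ ?_
    · refine ⟨a, b, Multiset.replicate (k * 2) a + D, h, ?_, ?_⟩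
      · rw [show (k + 1) * 2 = k * 2 + 1 + 1 by ring, Multiset.replicate_succ,
          Multiset.replicate_succ]
        simp
      · simp
    · simpa [Multiset.replicate_succ] using ih (b ::ₘ D)

/-- Moving pebbles along a walk. -/
theorem reach_walk {V : Type u} {G : SimpleGraph V} {a b : V} (p : G.Walk a b)
    (D : Configuration V) :
    Relation.ReflTransGen (Move G) (Multiset.replicate (2 ^ p.length) a + D) (b ::ₘ D) := by
  induction p with
  | nil => exact Relation.ReflTransGen.refl
  | cons h p ih =>
    rw [SimpleGraph.Walk.length_cons, pow_succ]
    exact (reach_adj h _ D).trans ih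

/-- On a finite connected graph the pebbling number is indeed attained as a least element. -/
theorem isLeast_pebblingNumber {V : Type u} [Finite V] {G : SimpleGraph V} (hG : G.Connected) :
    IsLeast {n : ℕ | ∀ C : Configuration V, Multiset.card C = n → ∀ r : V, Solvable G C r}
      (pebblingNumber G) := by
  classical
  have : Fintype V := Fintype.ofFinite V
  have : Nonempty V := hG.nonempty
  refine ⟨Nat.sInf_mem ⟨Fintype.card V * 2 ^ Fintype.card V, ?_⟩, fun n hn => Nat.sInf_le hn⟩
  intro C hC r
  obtain ⟨a, -, ha⟩ : ∃ a ∈ (Finset.univ : Finset V), 2 ^ Fintype.card V ≤ C.count a := by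
    apply Finset.exists_le_of_sum_le Finset.univ_nonempty
    rw [Multiset.sum_count_eq_card (fun x _ => Finset.mem_univ x), hC]
    simp
  obtain ⟨p, hp⟩ := hG.exists_isPath a r
  have hlen : 2 ^ p.length ≤ C.count a :=
    (Nat.pow_le_pow_right (by norm_num) hp.length_lt.le).trans ha
  obtain ⟨D, hD⟩ := Multiset.le_iff_exists_add.1 (Multiset.le_count_iff_replicate_le.1 hlen)
  exact ⟨r ::ₘ D, hD ▸ reach_walk p D, Multiset.mem_cons_self r D⟩

end Pebbling

namespace Pebbling

open Relation

variable {V : Type*} {W : Type*} {G : SimpleGraph V} {H : SimpleGraph W}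

/-! Write `p` for `pebblingNumber H`. In the fibre over a vertex `a` of `G`, any `p + 1` pebbles can
put a pebble on `(b, r)` for any neighbour `b` of `a` (`exists_reach_adj_fibre`): a diagonal edge
changes fibre at no extra cost. Hence such a group does the work of two pebbles on `a` in a pebbling
of `G` (`solvable_strongProduct_of_count_le`). Cutting every fibre into groups wastes at most `p`
pebbles per fibre, and the number of fibres is at most `pebblingNumber G`. -/

theorem Move.add_right {C C' : Configuration V} (h : Move G C C') (X : Configuration V) :
    Move G (C + X) (C' + X) := by
  obtain ⟨a, b, D, hab, rfl, rfl⟩ := h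
  exact ⟨a, b, D + X, hab, by simp, by simp⟩

theorem reach_add_right {C C' : Configuration V} (h : ReflTransGen (Move G) C C')
    (X : Configuration V) : ReflTransGen (Move G) (C + X) (C' + X) :=
  h.lift (· + X) fun _ _ h => h.add_right X

theorem Solvable.mono {C D : Configuration V} {r : V} (h : Solvable G C r) (hle : C ≤ D) :
    Solvable G D r := by
  obtain ⟨X, rfl⟩ := Multiset.le_iff_exists_add.1 hle
  obtain ⟨C', hC', hr⟩ := h
  exact ⟨C' + X, reach_add_right hC' X, Multiset.mem_add.2 (Or.inl hr)⟩

theorem Solvable.of_reach {C D : Configuration V} {r : V} (h : Solvable G D r)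
    (hCD : ReflTransGen (Move G) C D) : Solvable G C r := by
  obtain ⟨C', hC', hr⟩ := h
  exact ⟨C', hCD.trans hC', hr⟩

theorem exists_le_card_eq {α : Type*} {C : Multiset α} {n : ℕ} (h : n ≤ Multiset.card C) :
    ∃ D ≤ C, Multiset.card D = n := by
  induction C using Quotient.inductionOn with
  | h l => exact ⟨(l.take n : List α), (List.take_sublist n l).subperm, by simpa using h⟩

theorem solvable_of_pebblingNumber_le [Finite V] (hG : G.Connected) {C : Configuration V}
    (hC : pebblingNumber G ≤ Multiset.card C) (r : V) : Solvable G C r := by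
  obtain ⟨D, hD, hcard⟩ := exists_le_card_eq hC
  exact ((isLeast_pebblingNumber hG).1 D hcard r).mono hD

/-- With at most one pebble on each vertex other than `r` and none on `r`, no move is possible. -/
theorem natCard_le_pebblingNumber [Finite V] (hG : G.Connected) :
    Nat.card V ≤ pebblingNumber G := by
  classical
  have : Fintype V := Fintype.ofFinite V
  obtain ⟨r⟩ := hG.nonempty
  by_contra! hlt
  obtain ⟨C, hC, hcard⟩ : ∃ C ≤ (Finset.univ.erase r).val,
      Multiset.card C = pebblingNumber G := by
    apply exists_le_card_eq
    rw [Finset.card_val, Finset.card_erase_of_mem (Finset.mem_univ r), Finset.card_univ,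
      ← Nat.card_eq_fintype_card]
    omega
  have hnodup : C.Nodup := Multiset.nodup_of_le hC (Finset.nodup _)
  obtain ⟨C', hC', hr⟩ := (isLeast_pebblingNumber hG).1 C hcard r
  rcases hC'.cases_head with rfl | ⟨D, ⟨a, b, X, -, rfl, -⟩, -⟩
  · exact Finset.notMem_erase r Finset.univ (Multiset.mem_of_le hC hr)
  · simp at hnodup

theorem Move.map_fibre {C C' : Configuration W} (h : Move H C C') (v : V) :
    Move (strongProduct G H) (C.map (Prod.mk v)) (C'.map (Prod.mk v)) := by
  obtain ⟨a, b, D, hab, rfl, rfl⟩ := h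
  exact ⟨(v, a), (v, b), D.map (Prod.mk v), Or.inl ⟨rfl, hab⟩, by simp, by simp⟩

theorem Solvable.map_fibre {C : Configuration W} {r : W} (h : Solvable H C r) (v : V) :
    Solvable (strongProduct G H) (C.map (Prod.mk v)) (v, r) := by
  obtain ⟨C', hC', hr⟩ := h
  exact ⟨C'.map (Prod.mk v), hC'.lift _ fun _ _ h => h.map_fibre v,
    Multiset.mem_map_of_mem _ hr⟩

/-- If the target carries no pebble, the move that first reaches it in a fibre can be replaced by
a diagonal move, ending in a neighbouring fibre. -/
theorem exists_reach_adj_fibre_of_notMem {a b : V} (hab : G.Adj a b) {C C' : Configuration W}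
    {r : W} (h : ReflTransGen (Move H) C C') (hr : r ∈ C') (hrC : r ∉ C) :
    ∃ X, ReflTransGen (Move (strongProduct G H)) (C.map (Prod.mk a)) ((b, r) ::ₘ X) := by
  induction h using ReflTransGen.head_induction_on with
  | refl => exact absurd hr hrC
  | @head C E hCE _ ih =>
    by_cases hrE : r ∈ E
    · obtain ⟨x, y, D, hxy, rfl, rfl⟩ := hCE
      have hry : r = y := by
        rcases Multiset.mem_cons.1 hrE with h | h
        · exact h
        · simp [h] at hrC
      subst hry
      exact ⟨D.map (Prod.mk a), .single ⟨(a, x), (b, r), D.map (Prod.mk a),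
        Or.inr (Or.inr ⟨hab, hxy⟩), by simp, rfl⟩⟩
    · obtain ⟨X, hX⟩ := ih hrE
      exact ⟨X, .head (hCE.map_fibre a) hX⟩

/-- One pebble more than the pebbling number in a fibre suffices to reach any given vertex of a
neighbouring fibre. -/
theorem exists_reach_adj_fibre [Finite W] (hH : H.Connected) {a b : V} (hab : G.Adj a b)
    {C : Configuration W} (hC : pebblingNumber H + 1 ≤ Multiset.card C) (r : W) :
    ∃ X, ReflTransGen (Move (strongProduct G H)) (C.map (Prod.mk a)) ((b, r) ::ₘ X) := by
  classical
  by_cases hcount : 2 ≤ C.count r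
  · obtain ⟨D, rfl⟩ := Multiset.le_iff_exists_add.1 (Multiset.le_count_iff_replicate_le.1 hcount)
    exact ⟨D.map (Prod.mk a), .single ⟨(a, r), (b, r), D.map (Prod.mk a),
      Or.inr (Or.inl ⟨rfl, hab⟩), by simp [Multiset.replicate_succ], rfl⟩⟩
  -- At most one pebble lies on `r`; setting it aside leaves at least `pebblingNumber H` pebbles,
  -- none on `r`.
  · have hsplit := Multiset.filter_add_not (fun x => r = x) C
    have hcard := congrArg Multiset.card hsplit
    rw [Multiset.card_add, ← Multiset.count_eq_card_filter_eq] at hcard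
    obtain ⟨C', hC', hr⟩ := solvable_of_pebblingNumber_le hH
      (C := C.filter fun x => ¬ r = x) (by omega) r
    obtain ⟨X, hX⟩ := exists_reach_adj_fibre_of_notMem hab hC' hr (by simp)
    refine ⟨X + (C.filter fun x => r = x).map (Prod.mk a), ?_⟩
    rw [← Multiset.cons_add]
    convert reach_add_right hX _ using 1
    rw [← Multiset.map_add, add_comm, hsplit]

theorem exists_le_fibre {v : V} [DecidablePred fun x : V × W => x.1 = v]
    {E : Configuration (V × W)} {n : ℕ}
    (h : n ≤ Multiset.card (E.filter fun x => x.1 = v)) :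
    ∃ C : Configuration W, Multiset.card C = n ∧ C.map (Prod.mk v) ≤ E := by
  obtain ⟨D, hD, hcard⟩ := exists_le_card_eq h
  refine ⟨D.map Prod.snd, by simpa using hcard, ?_⟩
  have hmap : (D.map Prod.snd).map (Prod.mk v) = D := by
    rw [Multiset.map_map]
    conv_rhs => rw [← Multiset.map_id D]
    refine Multiset.map_congr rfl fun x hx => ?_
    have hx' := (Multiset.mem_filter.1 (Multiset.mem_of_le hD hx)).2
    simp [← hx']
  rw [hmap]
  exact hD.trans (Multiset.filter_le _ _)

/-- A configuration `A` on the fibre over `r`, together with further pebbles `E` of which every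
`pebblingNumber H + 1` in a fibre count as two, simulates a pebbling of `G`. -/
theorem solvable_strongProduct_of_count_le [Finite W] [DecidableEq V] (hH : H.Connected) {r : W}
    {s : V} {C C' : Configuration V} (h : ReflTransGen (Move G) C C') (hs : s ∈ C')
    (A : Configuration V) (E : Configuration (V × W))
    (hAE : ∀ v, C.count v ≤ A.count v +
      2 * (Multiset.card (E.filter fun x => x.1 = v) / (pebblingNumber H + 1))) :
    Solvable (strongProduct G H) (A.map (fun v => (v, r)) + E) (s, r) := by
  induction h using ReflTransGen.head_induction_on generalizing A E with
  | refl =>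
    by_cases hA : s ∈ A
    · exact ⟨_, .refl, Multiset.mem_add.2 (Or.inl (Multiset.mem_map_of_mem _ hA))⟩
    -- The pebble on `s` must come from a group in `E`, which solves `r` inside its own fibre.
    · have h1 := hAE s
      rw [Multiset.count_eq_zero_of_notMem hA] at h1
      have h2 := Multiset.count_pos.2 hs
      have h3 := (Nat.div_pos_iff.1 (Nat.pos_of_ne_zero (by omega) :
        0 < Multiset.card (E.filter fun x => x.1 = s) / (pebblingNumber H + 1))).2
      obtain ⟨F, hF, hFE⟩ := exists_le_fibre h3
      exact ((solvable_of_pebblingNumber_le hH (by omega) r).map_fibre s).mono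
        (hFE.trans (Multiset.le_add_left _ _))
  | @head C₁ C₂ hmove _ ih =>
    obtain ⟨a, b, D, hab, rfl, rfl⟩ := hmove
    by_cases hA : 2 ≤ A.count a
    · obtain ⟨B, rfl⟩ := Multiset.le_iff_exists_add.1 (Multiset.le_count_iff_replicate_le.1 hA)
      refine (ih (b ::ₘ B) E fun v => ?_).of_reach (.single ⟨(a, r), (b, r),
        B.map (fun v => (v, r)) + E, Or.inr (Or.inl ⟨rfl, hab⟩), ?_, ?_⟩)
      · have := hAE v
        simp only [Multiset.count_cons, Multiset.count_add, Multiset.count_replicate] at this ⊢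
        split_ifs at * <;> grind
      · simp [Multiset.replicate_succ]
      · simp
    -- `A` has at most one pebble on `a`, so `E` holds a group there. Spending it pays for the move;
    -- its leftovers `X` are ignored.
    · have h1 := hAE a
      rw [Multiset.count_cons_self, Multiset.count_cons_self] at h1
      have h3 := (Nat.div_pos_iff.1 (Nat.pos_of_ne_zero (by omega) :
        0 < Multiset.card (E.filter fun x => x.1 = a) / (pebblingNumber H + 1))).2
      obtain ⟨F, hF, hFE⟩ := exists_le_fibre h3
      obtain ⟨E', rfl⟩ := Multiset.le_iff_exists_add.1 hFE
      obtain ⟨X, hX⟩ := exists_reach_adj_fibre (G := G) hH hab hF.ge r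
      refine Solvable.of_reach (D := (b ::ₘ A).map (fun v => (v, r)) + E' + X)
        ((ih (b ::ₘ A) E' fun v => ?_).mono (Multiset.le_add_right _ _)) ?_
      · have hv := hAE v
        rw [Multiset.filter_add, Multiset.card_add] at hv
        by_cases hva : v = a
        · subst hva
          rw [Multiset.filter_eq_self.2 (by simp), Multiset.card_map, hF,
            Nat.add_div_left _ (Nat.add_one_pos _)] at hv
          simp only [Multiset.count_cons, if_true] at hv ⊢
          omega
        · rw [Multiset.filter_eq_nil.2 (by
            rintro x hx rfl
            obtain ⟨_, -, rfl⟩ := Multiset.mem_map.1 hx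
            exact hva rfl)] at hv
          simp only [Multiset.count_cons, hva, if_false, Multiset.card_zero, zero_add,
            add_zero] at hv ⊢
          omega
      · convert reach_add_right hX (A.map (fun v => (v, r)) + E') using 1
        · abel
        · simp only [Multiset.map_cons, Multiset.cons_add]
          congr 1
          abel

theorem solvable_strongProduct [Finite V] [Finite W] (hG : G.Connected) (hH : H.Connected)
    {D : Configuration (V × W)}
    (hD : pebblingNumber G * (pebblingNumber H + 1) + 2 * Nat.card V * pebblingNumber H ≤
      2 * Multiset.card D) (x : V × W) : Solvable (strongProduct G H) D x := by
  classical
  have : Fintype V := Fintype.ofFinite V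
  set p := pebblingNumber H
  let n : V → ℕ := fun v => Multiset.card (D.filter fun x => x.1 = v)
  let C : Configuration V := ∑ v, Multiset.replicate (2 * (n v / (p + 1))) v
  have hsum : Multiset.card D = ∑ v, n v := by
    rw [← Multiset.card_map Prod.fst D,
      ← Multiset.sum_count_eq_card (s := Finset.univ) (fun v _ => Finset.mem_univ v)]
    refine Finset.sum_congr rfl fun v _ => ?_
    rw [Multiset.count_map]
    simp only [n, eq_comm]
  have hcount : ∀ v, C.count v = 2 * (n v / (p + 1)) := fun v => by
    simp [C, Multiset.count_sum', Multiset.count_replicate]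
  have hcard : Multiset.card C = ∑ v, 2 * (n v / (p + 1)) := by simp [C]
  -- Each fibre loses only its remainder modulo `p + 1`, at most `p`.
  have hle : 2 * Multiset.card D ≤ (p + 1) * Multiset.card C + 2 * Nat.card V * p := by
    rw [hsum, hcard, Finset.mul_sum, Finset.mul_sum, Nat.card_eq_fintype_card,
      show 2 * Fintype.card V * p = ∑ _v : V, 2 * p by simp; ring, ← Finset.sum_add_distrib]
    refine Finset.sum_le_sum fun v _ => ?_
    have h1 := Nat.div_add_mod (n v) (p + 1)
    have h2 := Nat.le_of_lt_succ (Nat.mod_lt (n v) (Nat.add_one_pos p))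
    rw [mul_left_comm]
    linarith
  have hC : pebblingNumber G ≤ Multiset.card C :=
    Nat.le_of_mul_le_mul_left (c := p + 1) (by linarith [mul_comm (pebblingNumber G) (p + 1)])
      (Nat.add_one_pos p)
  obtain ⟨C', hC', hs⟩ := solvable_of_pebblingNumber_le hG hC x.1
  simpa using solvable_strongProduct_of_count_le (r := x.2) hH hC' hs 0 D
    fun v => by simpa using (hcount v).le

theorem two_mul_pebblingNumber_strongProduct_le [Finite V] [Finite W] (hG : G.Connected)
    (hH : H.Connected) :
    2 * pebblingNumber (strongProduct G H) ≤
      3 * (pebblingNumber G + 1) * (pebblingNumber H + 1) := by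
  have hV := Nat.mul_le_mul_right (pebblingNumber H) (natCard_le_pebblingNumber hG)
  have hle : pebblingNumber (strongProduct G H) ≤
      3 * (pebblingNumber G + 1) * (pebblingNumber H + 1) / 2 := by
    refine Nat.sInf_le fun D hD x => solvable_strongProduct hG hH ?_ x
    -- Rounding down costs at most 1 in `2 * card D`, which the slack in the bound absorbs.
    have h := Nat.div_add_mod (3 * (pebblingNumber G + 1) * (pebblingNumber H + 1)) 2
    have h2 := Nat.mod_lt (3 * (pebblingNumber G + 1) * (pebblingNumber H + 1)) two_pos
    rw [← hD] at h
    nlinarith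
  omega

end Pebbling

theorem theorem4p1 {V : Type*} {W : Type*} [Finite V] [Finite W]
    (G : SimpleGraph V) (H : SimpleGraph W) (hG : G.Connected) (hH : H.Connected) :
    (Pebbling.pebblingNumber (Pebbling.strongProduct G H) : ℝ) ≤
      3 / 2 * ((Pebbling.pebblingNumber G : ℝ) + 1) *
        ((Pebbling.pebblingNumber H : ℝ) + 1) := by
  have h : (2 * Pebbling.pebblingNumber (Pebbling.strongProduct G H) : ℝ) ≤
      3 * (Pebbling.pebblingNumber G + 1) * (Pebbling.pebblingNumber H + 1) := by
    exact_mod_cast Pebbling.two_mul_pebblingNumber_strongProduct_le hG hH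
  linarith
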